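/- **Conventions.** In a group $G$ write $a^b=b^{-1}ab$ and $[a,b]=a^{-1}b^{-1}ab$; iterated commutators are left-normed, $[a_1,\dots,a_n]=[[a_1,\dots,a_{n-1}],a_n]$. Let $\gamma_1(G)=G$ and $\gamma_{i+1}(G)=[\gamma_i(G),G]$ be the lower central series, and write $\langle g\rangle^G$ for the normal closure of $g$ in $G$. A *basic $\neg\mathsf{MP}$-witness pair* for $G$ (a pair witnessing that $G$ does not have the Magnus property) is a pair $(g,v)$ of elements of $G$ such that $v\in[G,G]$, $v\neq[g,w]$ for all $w\in G$, $g^2\notin[G,G]$, and $\langle g\rangle^G=\langle gv\rangle^G$. For $z,t\in G$ and a polynomial $q=\sum_{i=0}^n a_iT^i\in\mathbb{Z}[T]$ put $z^{q(t)}=\prod_{i=0}^n (z^{t^i})^{a_i}$, the factors being taken in the order of increasing $i$. **Proposition.** Let $c\ge 1$ be an integer and let $G$ be a free (class-$2$ nilpotent)-by-(class-$c$ nilpotent) group of rank $2$ with free generators $x,y$; that is, $G$ is the relatively free group, freely generated by $x$ and $y$, in the variety of all groups $H$ with $\gamma_3(\gamma_{c+1}(H))=1$. Then there exists a basic $\neg\mathsf{MP}$-witness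 pair for $G$. More precisely, put $K=\gamma_{c+1}(G)$, $z_1=[y,x,\dots,x]$ (with $c$ entries $x$), $z_2=[z_1,y]$ and $z=[z_1,z_2]$. Then $z\in[K,K]$, and there are a prime $p\ge5$ and a polynomial $f\in 1+(T-1)\mathbb{Z}[T]$ such that $g=x^pz$ and $v=z^{f(x)-1}$ form a basic $\neg\mathsf{MP}$-witness pair for $G$. -/

import Mathlib

open Polynomial

universe u v

section GroupNotions

variable {G : Type u} [Group G]

/-- Conjugation on the right, `a ^ b = b⁻¹ a b`. -/
def conjBy (a b : G) : G := b⁻¹ * a * b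

/-- The group commutator in the convention `[a, b] = a⁻¹ b⁻¹ a b = a⁻¹ a ^ b`. -/
def grpComm (a b : G) : G := a⁻¹ * b⁻¹ * a * b

/-- The left-normed commutator `[a, b, …, b]` with `n` entries `b`. -/
def iterComm (a b : G) : ℕ → G
  | 0 => a
  | n + 1 => grpComm (iterComm a b n) b

/-- For `q = ∑ aᵢ Tⁱ ∈ ℤ[T]`, the element `z ^ q(t) = ∏ᵢ ((z ^ (tⁱ)) ^ aᵢ)`, where
`z ^ (tⁱ)` is the conjugate of `z` by `tⁱ` and the factors are written in the order of
increasing `i` (the order is irrelevant when the conjugates of `z` commute). -/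
noncomputable def polyConjPow (z t : G) (q : ℤ[X]) : G :=
  ((List.range (q.natDegree + 1)).map fun i => conjBy z (t ^ i) ^ q.coeff i).prod

/-- `(g, v)` is a basic witness pair for the failure of the Magnus property:
`v ∈ [G,G]` is not of the form `[g, w]`, `g ^ 2` is non-trivial modulo `[G,G]`, and
`g`, `g v` have the same normal closure. -/
structure IsBasicWitnessPair (g v : G) : Prop where
  mem_commutator : v ∈ commutator G
  ne_comm : ∀ w : G, v ≠ grpComm g w
  sq_notMem : g ^ 2 ∉ commutator G
  normalClosure_eq : Subgroup.normalClosure {g} = Subgroup.normalClosure {g * v}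

end GroupNotions

/-- The iterated lower central series: for a class row `(c₁, …, c_l)` this is
`γ_{c_l + 1}(⋯ γ_{c₂ + 1}(γ_{c₁ + 1}(G)) ⋯)`.  Mathlib's series starts with
`K.lowerCentralSeries 0 = K`, so that `K.lowerCentralSeries c` is `γ_{c + 1}(K)`. -/
def iteratedLCS (G : Type u) [Group G] (cs : List ℕ) : Subgroup G :=
  cs.foldl (fun K c => K.lowerCentralSeries c) ⊤

/-- `G` is polynilpotent of class row `cs`. -/
def IsPolynilpotent (cs : List ℕ) (G : Type u) [Group G] : Prop :=
  iteratedLCS G cs = ⊥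

/-- `G` is a free polynilpotent group of class row `cs`, freely generated by the family `x`:
`G` lies in the variety, and every map from the generators to a group of the variety extends
uniquely to a homomorphism. -/
structure IsFreePolynilpotent (cs : List ℕ) {G : Type u} [Group G] {ι : Type v} (x : ι → G) :
    Prop where
  isPolynilpotent : IsPolynilpotent cs G
  existsUnique_hom : ∀ (H : Type u) [Group H], IsPolynilpotent cs H →
    ∀ h : ι → H, ∃! φ : G →* H, ∀ i, φ (x i) = h i

/-! Take p = 5 and f = T^4 + T^3 - T, so f(1) = 1 and f ≡ -(1 + T)^2 is a unit modulo Φ₅. Killing g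
= x^5 z makes z a power of x, so v = z^(f(x) - 1) dies too. Killing gv = x^5 z^f(x) makes z^f(x)
commute with x and x^5 with z, so (T - 1) f and T^5 - 1 annihilate z; they generate the ideal (T -
1), so v dies again and the normal closures agree (`normalClosure_pow_mul_eq`). If v = [g, w], then
g and gv are conjugate. Map G to triangular matrices over 𝔽₁₁: conjugation scales the corner entry
by squares, but passing from z to z^f(x) scales it by f(3) = -(1 + 3)^2, a non-square
(`mul_diagGen_pow_ne`). -/

open commutatorElement

section UpperTriangular

/-- The upper triangular matrices with rows `(1, u, a)`, `(0, s, v)`, `(0, 0, t ^ 2)`. -/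
@[ext]
structure UpperTri (R : Type*) [CommRing R] where
  s : Rˣ
  t : Rˣ
  u : R
  v : R
  a : R

namespace UpperTri

variable {R : Type*} [CommRing R]

instance : Mul (UpperTri R) where
  mul p q := ⟨p.s * q.s, p.t * q.t, q.u + p.u * q.s, p.s * q.v + p.v * q.t ^ 2,
    q.a + p.u * q.v + p.a * q.t ^ 2⟩

instance : One (UpperTri R) where
  one := ⟨1, 1, 0, 0, 0⟩

instance : Inv (UpperTri R) where
  inv p := ⟨p.s⁻¹, p.t⁻¹, -p.u * ↑p.s⁻¹, -↑p.s⁻¹ * p.v * ↑p.t⁻¹ ^ 2,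
    (p.u * ↑p.s⁻¹ * p.v - p.a) * ↑p.t⁻¹ ^ 2⟩

@[simp] lemma mul_s (p q : UpperTri R) : (p * q).s = p.s * q.s := rfl
@[simp] lemma mul_t (p q : UpperTri R) : (p * q).t = p.t * q.t := rfl
@[simp] lemma mul_u (p q : UpperTri R) : (p * q).u = q.u + p.u * q.s := rfl
@[simp] lemma mul_v (p q : UpperTri R) : (p * q).v = p.s * q.v + p.v * q.t ^ 2 := rfl
@[simp] lemma mul_a (p q : UpperTri R) :
    (p * q).a = q.a + p.u * q.v + p.a * q.t ^ 2 := rfl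
@[simp] lemma one_s : (1 : UpperTri R).s = 1 := rfl
@[simp] lemma one_t : (1 : UpperTri R).t = 1 := rfl
@[simp] lemma one_u : (1 : UpperTri R).u = 0 := rfl
@[simp] lemma one_v : (1 : UpperTri R).v = 0 := rfl
@[simp] lemma one_a : (1 : UpperTri R).a = 0 := rfl
@[simp] lemma inv_s (p : UpperTri R) : p⁻¹.s = p.s⁻¹ := rfl
@[simp] lemma inv_t (p : UpperTri R) : p⁻¹.t = p.t⁻¹ := rfl
@[simp] lemma inv_u (p : UpperTri R) : p⁻¹.u = -p.u * ↑p.s⁻¹ := rfl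
@[simp] lemma inv_v (p : UpperTri R) : p⁻¹.v = -↑p.s⁻¹ * p.v * ↑p.t⁻¹ ^ 2 := rfl
@[simp] lemma inv_a (p : UpperTri R) :
    p⁻¹.a = (p.u * ↑p.s⁻¹ * p.v - p.a) * ↑p.t⁻¹ ^ 2 := rfl

instance : Group (UpperTri R) :=
  Group.ofLeftAxioms
    (fun p q r => by
      ext <;> simp [mul_assoc] <;> ring)
    (fun p => by ext <;> simp)
    (fun p => by
      have h : (↑p.t⁻¹ : R) * p.t = 1 := p.t.inv_mul
      ext
      · simp
      · simp
      · simp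
      · simp only [mul_v, inv_s, inv_v, one_v]
        linear_combination -↑p.s⁻¹ * p.v * (↑p.t⁻¹ * ↑p.t + 1) * h
      · simp only [mul_a, inv_u, inv_a, one_a]
        linear_combination (p.u * ↑p.s⁻¹ * p.v - p.a) * (↑p.t⁻¹ * ↑p.t + 1) * h)

/-- The diagonal of a triangular matrix. -/
def diag : UpperTri R →* Rˣ × Rˣ where
  toFun p := (p.s, p.t)
  map_one' := rfl
  map_mul' _ _ := rfl

/-- The commutator of two unitriangular matrices. -/
lemma grpComm_unitriangular (u v a u' v' a' : R) :
    grpComm (⟨1, 1, u, v, a⟩ : UpperTri R) ⟨1, 1, u', v', a'⟩ =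
      ⟨1, 1, 0, 0, u * v' - u' * v⟩ := by
  ext
  all_goals simp [grpComm]
  ring

/-- The unitriangular matrices form a group of class two. -/
lemma commute_grpComm_of_diag_eq_one (p q r : UpperTri R) (hp : diag p = 1) (hq : diag q = 1)
    (hr : diag r = 1) : Commute (grpComm p q) r := by
  obtain ⟨_, _, pu, pv, pa⟩ := p
  obtain ⟨_, _, qu, qv, qa⟩ := q
  obtain ⟨_, _, ru, rv, ra⟩ := r
  simp only [diag, MonoidHom.coe_mk, OneHom.coe_mk, Prod.mk_eq_one] at hp hq hr
  obtain ⟨rfl, rfl⟩ := hp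
  obtain ⟨rfl, rfl⟩ := hq
  obtain ⟨rfl, rfl⟩ := hr
  rw [grpComm_unitriangular, commute_iff_eq]
  ext
  all_goals simp
  ring

end UpperTri

end UpperTriangular

/-! ### Non-conjugacy in a finite matrix quotient. -/

section UpperTriangularModEleven

instance : Fact (Nat.Prime 11) := ⟨by norm_num⟩

/-- A diagonal matrix over the field with eleven elements with corner entry `3`, a primitive fifth
root of unity. -/
def diagGen : UpperTri (ZMod 11) :=
  ⟨⟨2, 6, by decide, by decide⟩, ⟨5, 9, by decide, by decide⟩, 0, 0, 0⟩

/-- The product of a diagonal and a unitriangular matrix over the field with eleven elements. -/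
def triGen : UpperTri (ZMod 11) :=
  ⟨⟨2, 6, by decide, by decide⟩, 1, 1, 2, 0⟩

/-- On unitriangular matrices, conjugation by `diagGen` scales `u` by 2 and `v` by 6 · 3 = 7, so
each further commutator multiplies them by 1 and 6. -/
lemma iterComm_triGen (n : ℕ) : ∃ a,
    iterComm triGen diagGen (n + 1) = ⟨1, 1, 1, 6 ^ (n + 1), a⟩ := by
  induction n with
  | zero =>
    refine ⟨grpComm triGen diagGen |>.a, ?_⟩
    ext <;> decide
  | succ n ih =>
    obtain ⟨a, ha⟩ := ih
    rw [iterComm, ha]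
    refine ⟨_, UpperTri.ext ?_ ?_ ?_ ?_ rfl⟩
    · simp [grpComm]
    · simp [grpComm]
    · simp [grpComm, diagGen]
      reduce_mod_char
    · simp [grpComm, diagGen, pow_succ]
      generalize (6 : ZMod 11) ^ n = r
      revert r
      decide

/-- Here the conjugation factors are 2 and 2⁻¹ = 6. That 1 and 5 differ keeps the image of [z₁, z₂]
nontrivial. -/
lemma grpComm_triGen (u v a : ZMod 11) : ∃ a',
    grpComm (⟨1, 1, u, v, a⟩ : UpperTri (ZMod 11)) triGen = ⟨1, 1, u, 5 * v, a'⟩ := by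
  refine ⟨_, UpperTri.ext ?_ ?_ ?_ ?_ rfl⟩
  · simp [grpComm]
  · simp [grpComm]
  · simp [grpComm, triGen]
    revert u
    decide
  · simp [grpComm, triGen]
    revert v
    decide

lemma diagGen_pow (n : ℕ) : diagGen ^ n = ⟨diagGen.s ^ n, diagGen.t ^ n, 0, 0, 0⟩ := by
  induction n with
  | zero => rfl
  | succ n ih =>
    rw [pow_succ, ih]
    ext
    all_goals simp [diagGen, pow_succ]

lemma conjBy_diagGen_pow (ω : ZMod 11) (n : ℕ) :
    conjBy (⟨1, 1, 0, 0, ω⟩ : UpperTri (ZMod 11)) (diagGen ^ n) = ⟨1, 1, 0, 0, ω * 3 ^ n⟩ := by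
  have h : ((diagGen.t : ZMod 11) ^ n) ^ 2 = 3 ^ n := by
    rw [← pow_mul, mul_comm, pow_mul]
    congr 1
  rw [diagGen_pow]
  ext
  all_goals simp [conjBy, h]

/-- The conjugacy of the two elements would make the non-square `3 ^ 4 + 3 ^ 3 - 3 = 6` of the
field with eleven elements a square. -/
lemma mul_diagGen_pow_ne {ω : ZMod 11} (hω : ω ≠ 0) (w : UpperTri (ZMod 11)) :
    w * (diagGen ^ 5 * ⟨1, 1, 0, 0, ω * (3 ^ 4 + 3 ^ 3 - 3)⟩) ≠
      diagGen ^ 5 * ⟨1, 1, 0, 0, ω⟩ * w := by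
  intro h
  -- The fifth power is diagonal with outer entries 1, so `w.u`, `w.v` and `w.a` drop out of the
  -- corner equation.
  have ha := congrArg UpperTri.a h
  have h5 : (diagGen.t : ZMod 11) ^ 5 = 1 := by decide
  simp [diagGen_pow, h5] at ha
  have hsq : ∀ t : ZMod 11, t ^ 2 ≠ 3 ^ 4 + 3 ^ 3 - 3 := by decide
  refine hsq w.t (mul_left_cancel₀ hω ?_)
  linear_combination -ha

end UpperTriangularModEleven

/-! ### Membership in the variety and maps out of G. -/

section Varieties

/-- An extension of a group of class two by an abelian group is polynilpotent of class row
`[c, 2]` for every `c ≥ 1`. -/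
lemma isPolynilpotent_of_hom {c : ℕ} (hc : 1 ≤ c) {H B : Type*} [Group H] [CommGroup B]
    (π : H →* B)
    (h : ∀ p q r, π p = 1 → π q = 1 → π r = 1 → Commute (grpComm p q) r) :
    IsPolynilpotent [c, 2] H := by
  -- Index 1 is already the derived subgroup.
  have hker : (⊤ : Subgroup H).lowerCentralSeries c ≤ π.ker :=
    (Subgroup.lowerCentralSeries_antitone _ hc).trans (Abelianization.commutator_subset_ker π)
  have hbot : π.ker.lowerCentralSeries 2 = ⊥ := by
    simp only [Subgroup.lowerCentralSeries_succ, Subgroup.lowerCentralSeries_zero]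
    rw [Subgroup.commutator_eq_bot_iff_le_centralizer, Subgroup.commutator_le]
    intro p hp q hq
    rw [Subgroup.mem_centralizer_iff]
    intro r hr
    have := h p⁻¹ q⁻¹ r (by simpa using hp) (by simpa using hq) hr
    simpa [grpComm, commutatorElement_def] using this.eq.symm
  exact eq_bot_iff.mpr ((Subgroup.lowerCentralSeries_mono 2 hker).trans hbot.le)

lemma isPolynilpotent_ulift_upperTri {c : ℕ} (hc : 1 ≤ c) (R : Type*) [CommRing R] :
    IsPolynilpotent [c, 2] (ULift.{u} (UpperTri R)) := by
  refine isPolynilpotent_of_hom hc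
    (UpperTri.diag.comp (MulEquiv.ulift : ULift.{u} (UpperTri R) ≃* UpperTri R).toMonoidHom) ?_
  intro p q r hp hq hr
  exact (Commute.map (UpperTri.commute_grpComm_of_diag_eq_one p.down q.down r.down hp hq hr)
    (MulEquiv.ulift : ULift.{u} (UpperTri R) ≃* UpperTri R).symm)

lemma isPolynilpotent_of_commGroup {c : ℕ} (hc : 1 ≤ c) (A : Type*) [CommGroup A] :
    IsPolynilpotent [c, 2] A :=
  isPolynilpotent_of_hom hc (MonoidHom.id A) fun _ _ _ _ _ _ => Commute.all _ _

/-- A pair of elements of a group in the variety, possibly in a lower universe, is the image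
of the free generators. -/
lemma IsFreePolynilpotent.exists_hom_of_ulift {cs : List ℕ} {G : Type u} [Group G] {x y : G}
    (hG : IsFreePolynilpotent cs ![x, y]) {H : Type} [Group H]
    (hH : IsPolynilpotent cs (ULift.{u} H)) (a b : H) :
    ∃ φ : G →* H, φ x = a ∧ φ y = b := by
  obtain ⟨φ, hφ, -⟩ := hG.existsUnique_hom _ hH ![⟨a⟩, ⟨b⟩]
  refine ⟨(MulEquiv.ulift : ULift.{u} H ≃* H).toMonoidHom.comp φ, ?_, ?_⟩
  · exact congrArg ULift.down (hφ 0)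
  · exact congrArg ULift.down (hφ 1)

lemma grpComm_eq {G : Type*} [Group G] (a b : G) : grpComm a b = ⁅a⁻¹, b⁻¹⁆ := by
  simp [grpComm, commutatorElement_def]

lemma map_grpComm {G H : Type*} [Group G] [Group H] (φ : G →* H) (a b : G) :
    φ (grpComm a b) = grpComm (φ a) (φ b) := by
  simp [grpComm]

lemma map_conjBy {G H : Type*} [Group G] [Group H] (φ : G →* H) (a b : G) :
    φ (conjBy a b) = conjBy (φ a) (φ b) := by
  simp [conjBy]

lemma map_iterComm {G H : Type*} [Group G] [Group H] (φ : G →* H) (a b : G) (n : ℕ) :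
    φ (iterComm a b n) = iterComm (φ a) (φ b) n := by
  induction n with
  | zero => rfl
  | succ n ih => simp [iterComm, map_grpComm, ih]

end Varieties

/-! ### Relations forcing z to commute with x. -/

section FifthPower

/-- `T ^ 4 + T ^ 3 - T`, which is the unit `-(1 + T) ^ 2` modulo the fifth cyclotomic
polynomial. -/
noncomputable def fifthUnit : ℤ[X] := X ^ 4 + X ^ 3 - X

lemma polyConjPow_fifthUnit {G : Type*} [Group G] (z t : G) :
    polyConjPow z t (fifthUnit - 1) =
      z⁻¹ * (conjBy z t)⁻¹ * conjBy z (t ^ 3) * conjBy z (t ^ 4) := by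
  have hdeg : (fifthUnit - 1).natDegree = 4 := by
    unfold fifthUnit
    compute_degree!
  have h (i : ℕ) : (fifthUnit - 1).coeff i =
      (if i = 4 then 1 else 0) + (if i = 3 then 1 else 0) - (if 1 = i then 1 else 0) -
        (if i = 0 then 1 else 0) := by
    simp [fifthUnit, coeff_X_pow, coeff_X, coeff_one]
  simp [polyConjPow, hdeg, List.range_succ, h, conjBy, mul_assoc]

variable {Q : Type*} [Group Q] {x z : Q}

lemma conjBy_eq_self_of_commute (h : Commute x z) (n : ℕ) : conjBy z (x ^ n) = z := by
  rw [conjBy, mul_assoc, ← (h.pow_left n).eq, inv_mul_cancel_left]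

/-- The exponent is f(1) - 1 = 0. -/
lemma polyConjPow_fifthUnit_of_commute (h : Commute x z) :
    polyConjPow z x (fifthUnit - 1) = 1 := by
  have h1 := conjBy_eq_self_of_commute h 1
  rw [pow_one] at h1
  simp [polyConjPow_fifthUnit, conjBy_eq_self_of_commute h, h1]

lemma commute_of_pow_mul_eq_one (n : ℕ) (h : x ^ n * z = 1) : Commute x z := by
  rw [eq_inv_of_mul_eq_one_right h]
  exact ((Commute.refl x).pow_right n).inv_right

/-- If `x ^ 5 = z ^ (-f(x))` for `f = T ^ 4 + T ^ 3 - T` then `z` commutes with `x`, as `f` is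
invertible modulo the fifth cyclotomic polynomial. -/
lemma commute_of_pow_mul_polyConjPow_eq_one
    (hcomm : ∀ i j : ℕ, Commute (conjBy z (x ^ i)) (conjBy z (x ^ j)))
    (h : x ^ 5 * z * polyConjPow z x (fifthUnit - 1) = 1) : Commute x z := by
  set a : ℕ → Q := fun i => conjBy z (x ^ i) with ha
  have ha0 : a 0 = z := by simp [ha, conjBy]
  have hsucc (i : ℕ) : MulAut.conj x⁻¹ (a i) = a (i + 1) := by
    simp [ha, conjBy, pow_succ, mul_assoc]
  have hrel : x ^ 5 * ((a 1)⁻¹ * a 3 * a 4) = 1 := by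
    rw [← h, polyConjPow_fifthUnit]
    simp [ha, mul_assoc]
  have hW : MulAut.conj x⁻¹ ((a 1)⁻¹ * a 3 * a 4) = (a 1)⁻¹ * a 3 * a 4 := by
    rw [MulAut.conj_apply, mul_assoc, inv_inv, ← (commute_of_pow_mul_eq_one 5 hrel).eq,
      inv_mul_cancel_left]
  have h5 : a 5 = a 0 := by
    have hz : Commute (x ^ 5) z := by
      rw [eq_inv_of_mul_eq_one_left hrel, ← ha0]
      exact (((hcomm 1 0).inv_left.mul_left (hcomm 3 0)).mul_left (hcomm 4 0)).inv_left
    rw [ha0]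
    simpa using conjBy_eq_self_of_commute hz 1
  -- This is (T - 1) f = T^5 - T^3 - T^2 + T, reduced by T^5 = 1.
  have h0 : a 0 * a 1 = a 2 * a 3 := by
    rw [map_mul, map_mul, map_inv (MulAut.conj x⁻¹) (a 1), hsucc, hsucc, hsucc, h5] at hW
    have e1 : (a 2)⁻¹ * a 4 * a 0 = a 4 * ((a 2)⁻¹ * a 0) := by
      rw [← mul_assoc, (hcomm 2 4).inv_left.eq]
    have e2 : (a 1)⁻¹ * a 3 * a 4 = a 4 * ((a 1)⁻¹ * a 3) :=
      ((hcomm 1 4).inv_left.mul_left (hcomm 3 4)).eq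
    rw [e1, e2] at hW
    have e3 := mul_left_cancel hW
    rw [inv_mul_eq_iff_eq_mul, ← mul_assoc, ← (hcomm 1 2).inv_left.eq, mul_assoc,
      eq_inv_mul_iff_mul_eq] at e3
    rw [← e3]
    exact (hcomm 0 1).eq
  have h1 : a 1 * a 2 = a 3 * a 4 := by
    simpa only [map_mul, hsucc] using congrArg (MulAut.conj x⁻¹) h0
  have h2 : a 2 * a 3 = a 4 * a 0 := by
    rw [← h5]
    simpa only [map_mul, hsucc] using congrArg (MulAut.conj x⁻¹) h1
  -- 1 + T = T^2 + T^3 = T^4 + 1, the second equality being the first times T^2.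
  have h14 : a 1 = a 4 := by
    refine mul_left_cancel (a := a 0) ?_
    rw [h0, h2]
    exact (hcomm 4 0).eq
  have h20 : a 2 = a 0 := by
    rw [← h5]
    simpa only [hsucc] using congrArg (MulAut.conj x⁻¹) h14
  have h31 : a 3 = a 1 := by
    simpa only [hsucc] using congrArg (MulAut.conj x⁻¹) h20
  have h42 : a 4 = a 2 := by
    simpa only [hsucc] using congrArg (MulAut.conj x⁻¹) h31
  have h10 : a 1 = z := by rw [h14, h42, h20, ha0]
  have : x⁻¹ * z * x = z := by simpa [ha, conjBy] using h10
  rw [mul_assoc, inv_mul_eq_iff_eq_mul] at this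
  exact this.symm

end FifthPower

section NormalClosure

variable {G : Type*} [Group G] {x z : G}

lemma map_polyConjPow_fifthUnit {H : Type*} [Group H] (φ : G →* H) :
    φ (polyConjPow z x (fifthUnit - 1)) = polyConjPow (φ z) (φ x) (fifthUnit - 1) := by
  simp [polyConjPow_fifthUnit, map_conjBy]

lemma normalClosure_pow_mul_eq
    (hcomm : ∀ i j : ℕ, Commute (conjBy z (x ^ i)) (conjBy z (x ^ j))) :
    Subgroup.normalClosure {x ^ 5 * z} =
      Subgroup.normalClosure {x ^ 5 * z * polyConjPow z x (fifthUnit - 1)} := by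
  apply le_antisymm
  · rw [← Subgroup.normalClosure_subset_iff, Set.singleton_subset_iff, SetLike.mem_coe]
    set N := Subgroup.normalClosure {x ^ 5 * z * polyConjPow z x (fifthUnit - 1)}
    have hN : x ^ 5 * z * polyConjPow z x (fifthUnit - 1) ∈ N :=
      Subgroup.subset_normalClosure rfl
    rw [← QuotientGroup.ker_mk' N, MonoidHom.mem_ker] at hN ⊢
    have hv := hN
    simp only [map_mul, map_pow, map_polyConjPow_fifthUnit] at hv
    have := commute_of_pow_mul_polyConjPow_eq_one (fun i j => by
      simpa only [map_conjBy, map_pow] using (hcomm i j).map (QuotientGroup.mk' N)) hv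
    rwa [polyConjPow_fifthUnit_of_commute this, mul_one, ← map_pow, ← map_mul] at hv
  · rw [← Subgroup.normalClosure_subset_iff, Set.singleton_subset_iff, SetLike.mem_coe]
    set N := Subgroup.normalClosure {x ^ 5 * z}
    have hN : x ^ 5 * z ∈ N := Subgroup.subset_normalClosure rfl
    refine mul_mem hN ?_
    rw [← QuotientGroup.ker_mk' N, MonoidHom.mem_ker] at hN ⊢
    rw [map_mul, map_pow] at hN
    rw [map_polyConjPow_fifthUnit]
    exact polyConjPow_fifthUnit_of_commute (commute_of_pow_mul_eq_one 5 hN)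

end NormalClosure

theorem mainTheorem8 (c : ℕ) (hc : 1 ≤ c) {G : Type u} [Group G] (x y : G)
    (hG : IsFreePolynilpotent [c, 2] ![x, y])
    (K : Subgroup G) (hK : K = (⊤ : Subgroup G).lowerCentralSeries c)
    (z₁ z₂ z : G) (hz₁ : z₁ = iterComm y x c) (hz₂ : z₂ = grpComm z₁ y) (hz : z = grpComm z₁ z₂) :
    z ∈ ⁅K, K⁆ ∧
      ∃ g v : G, IsBasicWitnessPair g v ∧
        ∃ (p : ℕ) (f : ℤ[X]), p.Prime ∧ 5 ≤ p ∧ f.eval 1 = 1 ∧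
          g = x ^ p * z ∧ v = polyConjPow z x (f - 1) := by
  have hcomm_mem {A B : Subgroup G} {a b : G} (ha : a ∈ A) (hb : b ∈ B) : grpComm a b ∈ ⁅A, B⁆ :=
    grpComm_eq a b ▸ Subgroup.commutator_mem_commutator (inv_mem ha) (inv_mem hb)
  have hiter (n : ℕ) : iterComm y x n ∈ (⊤ : Subgroup G).lowerCentralSeries n := by
    induction n with
    | zero => exact Subgroup.mem_top _
    | succ n ih => exact hcomm_mem ih (Subgroup.mem_top _)
  have hKn : K.Normal := by subst hK; infer_instance
  have hz₁K : z₁ ∈ K := by rw [hz₁, hK]; exact hiter c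
  have hz₂K : z₂ ∈ K := by
    rw [hz₂]
    exact Subgroup.commutator_le_left K ⊤ (hcomm_mem hz₁K (Subgroup.mem_top y))
  have hzK : z ∈ ⁅K, K⁆ := by rw [hz]; exact hcomm_mem hz₁K hz₂K
  have hzcomm : z ∈ commutator G := Subgroup.commutator_mono le_top le_top hzK
  have hconj {N : Subgroup G} (hN : N.Normal) (hzN : z ∈ N) (i : ℕ) : conjBy z (x ^ i) ∈ N := by
    simpa [conjBy] using hN.conj_mem z hzN (x ^ i)⁻¹
  have hcentral : ⁅⁅K, K⁆, K⁆ = ⊥ := by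
    rw [hK]
    exact hG.isPolynilpotent
  have hcommute (i j : ℕ) : Commute (conjBy z (x ^ i)) (conjBy z (x ^ j)) := by
    have h := Subgroup.commutator_eq_bot_iff_le_centralizer.mp hcentral
      (hconj inferInstance hzK i)
    exact (Subgroup.mem_centralizer_iff.mp h _
      (hconj hKn (Subgroup.commutator_le_left K K hzK) j)).symm
  refine ⟨hzK, x ^ 5 * z, polyConjPow z x (fifthUnit - 1), ⟨?_, ?_, ?_, ?_⟩, 5, fifthUnit,
    by norm_num, le_rfl, by simp [fifthUnit], rfl, rfl⟩
  · have hc1 := hconj (inferInstance : (commutator G).Normal) hzcomm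
    rw [polyConjPow_fifthUnit]
    exact mul_mem (mul_mem (mul_mem (inv_mem hzcomm)
      (inv_mem (by simpa using hc1 1))) (hc1 3)) (hc1 4)
  · intro w hw
    obtain ⟨φ, hx, hy⟩ := hG.exists_hom_of_ulift
      (isPolynilpotent_ulift_upperTri hc (ZMod 11)) diagGen triGen
    obtain ⟨n, rfl⟩ : ∃ n, c = n + 1 := ⟨c - 1, by omega⟩
    obtain ⟨a₁, h₁⟩ := iterComm_triGen n
    obtain ⟨a₂, h₂⟩ := grpComm_triGen 1 (6 ^ (n + 1)) a₁
    have hφz₁ : φ z₁ = ⟨1, 1, 1, 6 ^ (n + 1), a₁⟩ := by rw [hz₁, map_iterComm, hx, hy, h₁]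
    have hφz₂ : φ z₂ = ⟨1, 1, 1, 5 * 6 ^ (n + 1), a₂⟩ := by
      rw [hz₂, map_grpComm, hφz₁, hy, h₂]
    have hφz := map_grpComm φ z₁ z₂
    rw [← hz, hφz₁, hφz₂, UpperTri.grpComm_unitriangular] at hφz
    have hω : (1 * (5 * 6 ^ (n + 1)) - 1 * 6 ^ (n + 1) : ZMod 11) ≠ 0 := by
      have h6 : (6 : ZMod 11) ≠ 0 := by decide
      have h4 : (4 : ZMod 11) ≠ 0 := by decide
      have := mul_ne_zero h4 (pow_ne_zero (n + 1) h6)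
      intro h
      exact this (by linear_combination h)
    generalize (1 * (5 * 6 ^ (n + 1)) - 1 * 6 ^ (n + 1) : ZMod 11) = ω at hφz hω
    have hφv : φ (z * polyConjPow z x (fifthUnit - 1)) =
        ⟨1, 1, 0, 0, ω * (3 ^ 4 + 3 ^ 3 - 3)⟩ := by
      have hc1 := conjBy_diagGen_pow ω 1
      rw [pow_one] at hc1
      rw [map_mul, map_polyConjPow_fifthUnit, polyConjPow_fifthUnit, hφz, hx,
        conjBy_diagGen_pow, conjBy_diagGen_pow, hc1]
      ext
      all_goals simp
      ring
    -- v = [g, w] is equivalent to w (g v) = g w.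
    refine mul_diagGen_pow_ne hω (φ w) ?_
    rw [← hφv, ← hφz, ← hx, ← map_pow, ← map_mul, ← map_mul, ← map_mul, ← map_mul, hw]
    congr 1
    simp [grpComm, mul_assoc]
  · intro hmem
    -- The exponent sum in x takes g^2 to 10.
    obtain ⟨φ, hx, -⟩ := hG.exists_hom_of_ulift (H := Multiplicative ℤ)
      (isPolynilpotent_of_commGroup hc _) (Multiplicative.ofAdd 1) 1
    have hker := Abelianization.commutator_subset_ker φ
    have hφz : φ z = 1 := hker hzcomm
    have h1 : φ ((x ^ 5 * z) ^ 2) = 1 := hker hmem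
    rw [map_pow, map_mul, map_pow, hφz, hx] at h1
    revert h1
    decide
  · exact normalClosure_pow_mul_eq hcommute
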